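/- **Data model.** Let $\mathcal I$, $\mathcal L$, $\mathcal V$ be pairwise disjoint countably infinite sets (identifiers, literals, variables), each with a fixed numbering by $\mathbb N$; the numberings provide binary representations $\mathrm{enc}(\cdot)$ of all these elements and total orders. A *data triple* is an element of $\mathcal I\times\mathcal I\times(\mathcal I\cup\mathcal L)$. A *Web of Linked Data* is a triple $W=(D,\mathit{data},\mathit{adoc})$ where $D$ is a finite or countably infinite set of documents, $\mathit{data}$ maps each $d\in D$ to a finite set of data triples, and $\mathit{adoc}:\mathcal I\to D$ is a partial surjective map. $W$ is finite if $D$ is, and $\mathrm{AllData}(W)=\bigcup_{d\in D}\mathit{data}(d)$. **Queries.** A *basic query pattern* (BQP) is a finite set of triple patterns, i.e. elements of $(\mathcal V\cup\mathcal I)\times(\mathcal V\cup\mathcal I)\times(\mathcal V\cup\mathcal I\cup\mathcal L)$. A *reachability criterion* is a computable function $c$ that maps each (data triple, identifier, BQP) to true or false. It is *less restrictive* than $c'$ if $c$ is true whenever $c'$ is and $c$ is true, $c'$ false in at least one case; $c_{\mathsf{None}}$ is the constant false. For a finite $S\subset\mathcal I$ (seeds), a criterion $c$ and a BQP $B$,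 the documents $(c,B)$-reachable from $S$ in $W$ are the least set that contains $\mathit{adoc}(i)$ for all $i\in S\cap\mathrm{dom}(\mathit{adoc})$ and contains $\mathit{adoc}(i)$ whenever $i\in\mathrm{dom}(\mathit{adoc})$ occurs in a triple $t\in\mathit{data}(d')$ of a reachable document $d'$ with $c(t,i,B)=\mathrm{true}$. The *$(S,c,B)$-reachable part* of $W$ is the subweb of $W$ induced by the reachable documents. The *result* $Q^{B,S}_c(W)$ of the conjunctive Linked Data (CLD) query given by $B,S,c$ is the set of valuations $\mu$ (maps from finite subsets of $\mathcal V$ to $\mathcal I\cup\mathcal L$) such that $\mathrm{dom}(\mu)$ is the set of variables of $B$ and $\mu[B]\subseteq\mathrm{AllData}(R)$, where $R$ is the $(S,c,B)$-reachable part of $W$. **Machines.** A document is encoded by its ordered set of data triples, and $W$ by the (possibly infinite) word $\sharp\,\mathrm{enc}(i_1)\,\mathrm{enc}(\mathit{adoc}(i_1))\,\sharp\,\mathrm{enc}(i_2)\,\mathrm{enc}(\mathit{adoc}(i_2))\,\sharp\cdots$, where $i_1,i_2,\dots$ are the identifiers in $\mathrm{dom}(\mathit{adoc})$ in increasing order.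 An *LD machine* is a deterministic Turing machine with a finite set of states, among them accepting, rejecting and *expand* states, and five tapes: a read-only input tape, a right-infinite Web tape that is accessible only in the expand state, a two-way infinite work tape, a right-infinite link traversal (work) tape, and an append-only output tape. Initially the Web tape contains $\mathrm{enc}(W)$, the input tape an encoding of the further input, and the other tapes are empty. In the expand state, if a suffix of the word on the link traversal tape is $\mathrm{enc}(i)$ for some $i\in\mathcal I$ (the longest such suffix is taken) and $\sharp\,\mathrm{enc}(i)\,\mathrm{enc}(\mathit{adoc}(i))\,\sharp$ occurs on the Web tape, then $\mathrm{enc}(\mathit{adoc}(i))\,\sharp$ is appended to that word; otherwise $\sharp$ is appended. The machine then continues by its transition function. A decision problem about pairs $(W,X)$ is *LD machine decidable* if some LD machine, for every Web $W$ on the Web tape and every admissible $X$ encoded on the input tape, halts in the accepting state if the answer for $(W,X)$ is yes and in the rejecting state otherwise. **Theorem.** Consider the following two problems. The Web input is an arbitrary (finite or infinite) Web of Linked Data $W$. The further input is a CLD query given by $S$, $B$ and $c$ ($c$ being presented by a program that computes it), where $S$ is nonempty and $c$ is less restrictive than $c_{\mathsf{None}}$. * FinitenessReachablePart: is the $(S,c,B)$-reachable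 part of $W$ finite? * FinitenessQueryResult: is $Q^{B,S}_c(W)$ finite? Neither FinitenessReachablePart nor FinitenessQueryResult is LD machine decidable. -/

import Mathlib

namespace LinkedData

universe u v w

/-! ## Data model -/

section DataModel

/-- A data triple: identifier, identifier, identifier or constant literal. The sets `I` of
identifiers, `L` of literals and `V` of query variables are made disjoint by disjoint sums. -/
abbrev DataTriple (I : Type u) (L : Type v) := I × I × (I ⊕ L)

/-- The set of all identifiers in a data triple. -/
def DataTriple.ids {I : Type u} {L : Type v} (t : DataTriple I L) : Set I :=
  {i | i = t.1 ∨ i = t.2.1 ∨ Sum.inl i = t.2.2}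

/-- A Web of Linked Data: an at most countable set `D` of documents, a finite set of data triples
for each document, and a partial surjection `adoc` from the identifiers onto the documents. -/
structure Web (I : Type u) (L : Type v) where
  D : Type
  countable_D : Countable D
  data : D → Finset (DataTriple I L)
  adoc : I → Option D
  adoc_surj : ∀ d : D, ∃ i : I, adoc i = some d

variable {I : Type u} {L : Type v}

/-- A Web is finite if it has finitely many documents. -/
def Web.IsFinite (W : Web I L) : Prop := Finite W.D

/-- The set of all data triples in a Web. -/
def Web.allData (W : Web I L) : Set (DataTriple I L) := {t | ∃ d : W.D, t ∈ W.data d}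

open Classical in
/-- The subweb of `W` that is induced by the set `D'` of documents. -/
noncomputable def Web.induced (W : Web I L) (D' : Set W.D) : Web I L where
  D := D'
  countable_D := by
    have := W.countable_D
    infer_instance
  data := fun d => W.data d.1
  adoc := fun i => (W.adoc i).bind fun d => if h : d ∈ D' then some ⟨d, h⟩ else none
  adoc_surj := by
    rintro ⟨d, hd⟩
    obtain ⟨i, hi⟩ := W.adoc_surj d
    exact ⟨i, by simp [hi, hd]⟩

end DataModel

/-! ## Conjunctive Linked Data queries -/

section QueryModel

/-- A triple pattern. -/
abbrev TriplePattern (I : Type u) (L : Type v) (V : Type w) :=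
  (V ⊕ I) × (V ⊕ I) × (V ⊕ (I ⊕ L))

/-- A basic query pattern (BQP): a finite set of triple patterns. -/
abbrev BQP (I : Type u) (L : Type v) (V : Type w) := Finset (TriplePattern I L V)

/-- A valuation: a mapping from a finite set of variables to identifiers and literals. -/
structure Valuation (I : Type u) (L : Type v) (V : Type w) where
  toFun : V → Option (I ⊕ L)
  finite_dom : {x : V | (toFun x).isSome}.Finite

variable {I : Type u} {L : Type v} {V : Type w}

/-- The domain of a valuation. -/
def Valuation.dom (μ : Valuation I L V) : Set V := {x | (μ.toFun x).isSome}

/-- A triple whose components are arbitrary variables, identifiers or literals: the common home of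
data triples and of triple patterns to which a valuation has been applied. -/
abbrev GenTriple (I : Type u) (L : Type v) (V : Type w) :=
  (V ⊕ (I ⊕ L)) × (V ⊕ (I ⊕ L)) × (V ⊕ (I ⊕ L))

/-- A data triple as a general triple. -/
def DataTriple.toGen (t : DataTriple I L) : GenTriple I L V :=
  (Sum.inr (Sum.inl t.1), Sum.inr (Sum.inl t.2.1), Sum.inr t.2.2)

/-- A triple pattern as a general triple. -/
def TriplePattern.toGen (tp : TriplePattern I L V) : GenTriple I L V :=
  (Sum.map id Sum.inl tp.1, Sum.map id Sum.inl tp.2.1, tp.2.2)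

/-- The variables in a triple pattern. -/
def TriplePattern.vars (tp : TriplePattern I L V) : Set V :=
  {x | tp.1 = Sum.inl x ∨ tp.2.1 = Sum.inl x ∨ tp.2.2 = Sum.inl x}

/-- The variables in a BQP. -/
def BQP.vars (B : BQP I L V) : Set V := {x | ∃ tp ∈ B, x ∈ TriplePattern.vars tp}

/-- Replace a variable in the domain of `μ` by its value; leave everything else unchanged. -/
def Valuation.applyTerm (μ : Valuation I L V) : V ⊕ (I ⊕ L) → V ⊕ (I ⊕ L)
  | Sum.inl x => match μ.toFun x with
    | some a => Sum.inr a
    | none => Sum.inl x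
  | Sum.inr a => Sum.inr a

/-- `μ[tp]`. -/
def Valuation.applyPattern (μ : Valuation I L V) (tp : TriplePattern I L V) : GenTriple I L V :=
  (μ.applyTerm tp.toGen.1, μ.applyTerm tp.toGen.2.1, μ.applyTerm tp.toGen.2.2)

/-- `μ[B]`. -/
def Valuation.applyBQP (μ : Valuation I L V) (B : BQP I L V) : Set (GenTriple I L V) :=
  {g | ∃ tp ∈ B, μ.applyPattern tp = g}

/-- A function of a data triple, an identifier and a BQP as a function of the number of its
argument, in the numbering of these argument triples that comes from those of `I`, `L` and `V`. -/
def onNumbers [Denumerable I] [Denumerable L] [Denumerable V]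
    (f : DataTriple I L → I → BQP I L V → Bool) (n : ℕ) : Bool :=
  let p := Denumerable.ofNat (DataTriple I L × I × BQP I L V) n
  f p.1 p.2.1 p.2.2

/-- A reachability criterion: a (Turing) computable function that maps a data triple, an identifier
and a BQP to a truth value. -/
structure ReachabilityCriterion (I : Type u) (L : Type v) (V : Type w)
    [Denumerable I] [Denumerable L] [Denumerable V] where
  toFun : DataTriple I L → I → BQP I L V → Bool
  computable : Computable (onNumbers toFun)

/-- The criterion `c_None`, which is always false. -/
def cNone (I : Type u) (L : Type v) (V : Type w)
    [Denumerable I] [Denumerable L] [Denumerable V] : ReachabilityCriterion I L V where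
  toFun := fun _ _ _ => false
  computable := Computable.const false

/-- `c` is less restrictive than `c'`: it is true whenever `c'` is, and in at least one further
case. -/
def ReachabilityCriterion.LessRestrictive [Denumerable I] [Denumerable L] [Denumerable V]
    (c c' : ReachabilityCriterion I L V) : Prop :=
  (∀ t i B, c'.toFun t i B = true → c.toFun t i B = true) ∧
    ∃ t i B, c.toFun t i B = true ∧ c'.toFun t i B = false

variable [Denumerable I] [Denumerable L] [Denumerable V]

/-- `Reachable W S c B d`: the document `d` is `(c, B)`-reachable from `S` in `W`. -/
inductive Reachable (W : Web I L) (S : Finset I) (c : ReachabilityCriterion I L V)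
    (B : BQP I L V) : W.D → Prop
  | seed {i : I} {d : W.D} (hi : i ∈ S) (hd : W.adoc i = some d) : Reachable W S c B d
  | link {d' d : W.D} {t : DataTriple I L} {i : I} (hd' : Reachable W S c B d')
      (ht : t ∈ W.data d') (hi : i ∈ DataTriple.ids t) (hc : c.toFun t i B = true)
      (hd : W.adoc i = some d) : Reachable W S c B d

/-- The `(S, c, B)`-reachable part of `W`. -/
noncomputable def reachablePart (W : Web I L) (S : Finset I) (c : ReachabilityCriterion I L V)
    (B : BQP I L V) : Web I L :=
  W.induced {d | Reachable W S c B d}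

/-- The result of the conjunctive Linked Data query given by `B`, `S` and `c` over `W`. -/
def queryResult (W : Web I L) (S : Finset I) (c : ReachabilityCriterion I L V)
    (B : BQP I L V) : Set (Valuation I L V) :=
  {μ | μ.dom = BQP.vars B ∧
    μ.applyBQP B ⊆ DataTriple.toGen '' (reachablePart W S c B).allData}

end QueryModel

/-! ## Encodings

The numberings of `I`, `L` and `V` provide the binary representations and the total orders (of
order type `ω`, so that a Web with infinitely many documents is encoded by one infinite word). -/

section Encodings

/-- The symbols used for encodings: bits, the separator `♯`, a comma, the brackets of tuples and
the double brackets of finite sets. -/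
inductive Symbol
  | bit (b : Bool)
  | sharp
  | comma
  | tupleOpen
  | tupleClose
  | setOpen
  | setClose

/-- The binary numeral of a natural number, most significant bit first. -/
def encNat (n : ℕ) : List Symbol := n.bits.reverse.map Symbol.bit

variable {I : Type u} {L : Type v} {V : Type w} [Denumerable I] [Denumerable L] [Denumerable V]

/-- The binary representation of an identifier. Identifiers, literals and variables use different
residue classes modulo three, so that they have different representations. -/
def encId (i : I) : List Symbol := encNat (3 * Encodable.encode i + 1)

/-- The binary representation of a literal. -/
def encLit (l : L) : List Symbol := encNat (3 * Encodable.encode l + 2)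

/-- The binary representation of a variable. -/
def encVar (x : V) : List Symbol := encNat (3 * Encodable.encode x + 3)

/-- The encoding of a variable, identifier or literal. -/
def encTerm : V ⊕ (I ⊕ L) → List Symbol
  | Sum.inl x => encVar x
  | Sum.inr (Sum.inl i) => encId i
  | Sum.inr (Sum.inr l) => encLit l

/-- The encoding of a tuple from the encodings of its components. -/
def encTuple (ws : List (List Symbol)) : List Symbol :=
  [Symbol.tupleOpen] ++ List.intercalate [Symbol.comma] ws ++ [Symbol.tupleClose]

/-- The elements of a finite set as a list, in increasing order. -/
def sortedList {α : Type*} [Denumerable α] (s : Finset α) : List α :=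
  ((s.map ⟨Encodable.encode, Encodable.encode_injective⟩).sort (· ≤ ·)).map (Denumerable.ofNat α)

/-- The encoding of a finite set, with its elements in increasing order. -/
def encFinset {α : Type*} [Denumerable α] (enc : α → List Symbol) (s : Finset α) : List Symbol :=
  [Symbol.setOpen] ++ List.intercalate [Symbol.comma] ((sortedList s).map enc) ++
    [Symbol.setClose]

/-- The encoding of a general triple. -/
def encGenTriple (g : GenTriple I L V) : List Symbol :=
  encTuple [encTerm g.1, encTerm g.2.1, encTerm g.2.2]

/-- The encoding of a data triple. -/
def encDataTriple (t : DataTriple I L) : List Symbol :=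
  encTuple [encId t.1, encId t.2.1, Sum.elim encId encLit t.2.2]

/-- The encoding of a document: that of its set of data triples. -/
def Web.encDoc (W : Web I L) (d : W.D) : List Symbol := encFinset encDataTriple (W.data d)

/-- The part of the encoding of `W` that belongs to the `n`-th identifier `i`:
`enc(i) enc(adoc(i)) ♯` if `adoc(i)` is defined, and nothing otherwise. -/
def Web.encBlock (W : Web I L) (n : ℕ) : List Symbol :=
  match W.adoc (Denumerable.ofNat I n) with
  | some d => encId (Denumerable.ofNat I n) ++ W.encDoc d ++ [Symbol.sharp]
  | none => []

/-- The initial part of the encoding of `W` that belongs to the first `N` identifiers. -/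
def Web.encInit (W : Web I L) (N : ℕ) : List Symbol :=
  Symbol.sharp :: (List.range N).flatMap W.encBlock

open Classical in
/-- The Web tape: the finite or infinite word `♯ enc(i₁) enc(adoc(i₁)) ♯ enc(i₂) enc(adoc(i₂)) ♯ …`,
where `i₁, i₂, …` are the identifiers in the domain of `adoc` in increasing order, followed by
blanks if it is finite. -/
noncomputable def Web.tape (W : Web I L) (k : ℕ) : Option Symbol :=
  if h : ∃ N, k < (W.encInit N).length then (W.encInit (Nat.find h))[k]? else none

/-- The word `x` occurs on the tape `f`. -/
def OccursOn (x : List Symbol) (f : ℕ → Option Symbol) : Prop :=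
  ∃ a, ∀ (k : ℕ) (hk : k < x.length), f (a + k) = some x[k]

end Encodings

/-! ## LD machines -/

section Machines

/-- A head movement. -/
inductive Move
  | left
  | stay
  | right

/-- A tape cell: blank, an encoding symbol, or an additional symbol of the machine. -/
abbrev Cell (A : Type) := Option (Symbol ⊕ A)

/-- An encoded word as a list of tape cells. -/
def toCells {A : Type} (x : List Symbol) : List (Cell A) := x.map fun s => some (Sum.inl s)

/-- What an ordinary transition does: the next state, the movement on the read-only input tape,
the symbols written to and the movements on the work tape and the link traversal tape, and the
symbol, if any, appended to the output tape. -/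
structure Action (Q A : Type) where
  next : Q
  inputMove : Move
  workWrite : Cell A
  workMove : Move
  linkWrite : Cell A
  linkMove : Move
  output : Option (Symbol ⊕ A)

/-- An LD machine. The transition function receives the state and the symbols scanned on the input
tape, the work tape and the link traversal tape, in this order. -/
structure LDMachine where
  Q : Type
  finite_Q : Finite Q
  A : Type
  finite_A : Finite A
  start : Q
  accept : Q
  reject : Q
  expand : Q
  accept_ne_reject : accept ≠ reject
  expand_ne_accept : expand ≠ accept
  expand_ne_reject : expand ≠ reject
  δ : Q → Cell A → Cell A → Cell A → Action Q A

/-- A right-infinite tape with a head. -/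
structure RightTape (A : Type) where
  cells : ℕ → Cell A
  head : ℕ

namespace RightTape

variable {A : Type}

/-- The blank tape. -/
def blank : RightTape A := ⟨fun _ => none, 0⟩

/-- The scanned symbol. -/
def read (t : RightTape A) : Cell A := t.cells t.head

/-- Write to the scanned cell. -/
def write (t : RightTape A) (a : Cell A) : RightTape A :=
  ⟨Function.update t.cells t.head a, t.head⟩

/-- Move the head; a move to the left of the first cell has no effect. -/
def move (t : RightTape A) : Move → RightTape A
  | Move.left => ⟨t.cells, t.head - 1⟩
  | Move.stay => t
  | Move.right => ⟨t.cells, t.head + 1⟩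

/-- The number of cells up to the last nonblank one. -/
noncomputable def length (t : RightTape A) : ℕ := sInf {N | ∀ n ≥ N, t.cells n = none}

/-- The word stored on the tape. -/
noncomputable def word (t : RightTape A) : List (Cell A) := (List.range t.length).map t.cells

/-- Append a word to the right end of the stored word. The head stays in place. -/
noncomputable def append (t : RightTape A) (x : List (Cell A)) : RightTape A :=
  ⟨fun n => if n < t.length then t.cells n else (x[n - t.length]?).getD none, t.head⟩

end RightTape

/-- Move the head of a two-way infinite tape. -/
def moveTape {A : Type} (t : Turing.Tape (Cell A)) : Move → Turing.Tape (Cell A)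
  | Move.left => t.move Turing.Dir.left
  | Move.stay => t
  | Move.right => t.move Turing.Dir.right

variable {I : Type u} {L : Type v} [Denumerable I] [Denumerable L]

/-- The encoding of the identifier `i` is a suffix of the word `x`, and the longest one that is the
encoding of an identifier. (The longest one is taken because one binary representation may be a
suffix of another one.) -/
def IsSuffixId {A : Type} (x : List (Cell A)) (i : I) : Prop :=
  toCells (encId i) <:+ x ∧ ∀ j : I, toCells (encId j) <:+ x → (encId j).length ≤ (encId i).length

open Classical in
/-- The identifier whose encoding is the suffix of the word `x`, if there is one. -/
noncomputable def suffixId (I : Type u) [Denumerable I] {A : Type} (x : List (Cell A)) : Option I :=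
  if h : ∃ i : I, IsSuffixId x i then some h.choose else none

open Classical in
/-- The word that the expand procedure appends if `x` is the word on the link traversal tape and
`W` is encoded on the Web tape: if the suffix of `x` is the encoding of some identifier `i` and
`♯ enc(i) enc(adoc(i)) ♯` occurs on the Web tape, then `enc(adoc(i)) ♯`; otherwise `♯`. -/
noncomputable def expansion (W : Web I L) {A : Type} (x : List (Cell A)) : List Symbol :=
  match suffixId I x with
  | none => [Symbol.sharp]
  | some i =>
    match W.adoc i with
    | none => [Symbol.sharp]
    | some d =>
      if OccursOn ([Symbol.sharp] ++ encId i ++ W.encDoc d ++ [Symbol.sharp]) W.tape then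
        W.encDoc d ++ [Symbol.sharp]
      else [Symbol.sharp]

namespace LDMachine

/-- A configuration. The (read-only) content of the Web tape is not part of it. -/
structure Config (M : LDMachine) where
  state : M.Q
  input : Turing.Tape (Cell M.A)
  work : Turing.Tape (Cell M.A)
  link : RightTape M.A
  output : List (Symbol ⊕ M.A)

variable (M : LDMachine)

/-- The initial configuration: the word `x` is on the ordinary input tape, and the work tape, the
link traversal tape and the output tape are empty. -/
def init (x : List Symbol) : M.Config :=
  ⟨M.start, Turing.Tape.mk₁ (toCells x), Turing.Tape.mk₁ [], RightTape.blank, []⟩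

/-- An ordinary transition of a Turing machine. -/
def transition (C : M.Config) : M.Config :=
  let a := M.δ C.state C.input.head C.work.head C.link.read
  { state := a.next
    input := moveTape C.input a.inputMove
    work := moveTape (C.work.write a.workWrite) a.workMove
    link := (C.link.write a.linkWrite).move a.linkMove
    output := C.output ++ a.output.toList }

open Classical in
/-- One step with `W` encoded on the Web tape. The machine stops in the accepting and in the
rejecting state; in the expand state it performs the expand procedure and then proceeds by the
transition function. -/
noncomputable def step (W : Web I L) (C : M.Config) : M.Config :=
  if C.state = M.accept ∨ C.state = M.reject then C
  else if C.state = M.expand then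
    M.transition { C with link := C.link.append (toCells (expansion W C.link.word)) }
  else M.transition C

/-- The configuration after `n` steps. -/
noncomputable def run (W : Web I L) (x : List Symbol) (n : ℕ) : M.Config :=
  (M.step W)^[n] (M.init x)

/-- With `W` on the Web tape and `x` on the input tape, the machine halts in the accepting state. -/
def Accepts (W : Web I L) (x : List Symbol) : Prop := ∃ n, (M.run W x n).state = M.accept

/-- With `W` on the Web tape and `x` on the input tape, the machine halts in the rejecting state. -/
def Rejects (W : Web I L) (x : List Symbol) : Prop := ∃ n, (M.run W x n).state = M.reject

end LDMachine

/-- The decision problem `DP` about Webs from `𝒲` and further inputs from `𝒳`, which are encoded by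
`enc`, is LD machine decidable. -/
def LDMachineDecidable {X : Type*} (enc : X → List Symbol) (𝒲 : Set (Web I L)) (𝒳 : Set X)
    (DP : Set (Web I L × X)) : Prop :=
  ∃ M : LDMachine, ∀ W ∈ 𝒲, ∀ x ∈ 𝒳,
    ((W, x) ∈ DP → M.Accepts W (enc x)) ∧ ((W, x) ∉ DP → M.Rejects W (enc x))

end Machines

/-! ## The decision problems -/

section Problems

/-- A conjunctive Linked Data (CLD) query as a finite structure: a finite set `S` of seed
identifiers, a BQP `B`, and a reachability criterion `c` together with a program (a code of a
partial recursive function) that computes `c` (with `0` for false and `1` for true). -/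
structure CLDQuery (I : Type u) (L : Type v) (V : Type w)
    [Denumerable I] [Denumerable L] [Denumerable V] where
  S : Finset I
  B : BQP I L V
  c : ReachabilityCriterion I L V
  program : Nat.Partrec.Code
  program_eval : ∀ n : ℕ, program.eval n = Part.some (Encodable.encode (onNumbers c.toFun n))

variable {I : Type u} {L : Type v} {V : Type w} [Denumerable I] [Denumerable L] [Denumerable V]

/-- The encoding of a CLD query: that of the seeds, the program (as a number) and the BQP. -/
def CLDQuery.enc (q : CLDQuery I L V) : List Symbol :=
  encTuple [encFinset encId q.S, encNat (Encodable.encode q.program),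
    encFinset (fun tp => encGenTriple (TriplePattern.toGen tp)) q.B]

/-- The admissible queries: the set of seeds is nonempty and the criterion is less restrictive than
`c_None`. -/
def admissibleQueries (I : Type u) (L : Type v) (V : Type w)
    [Denumerable I] [Denumerable L] [Denumerable V] : Set (CLDQuery I L V) :=
  {q | q.S.Nonempty ∧ q.c.LessRestrictive (cNone I L V)}

/-- The pairs of a Web and an admissible query for which the reachable part of the Web is finite. -/
def FinitenessReachablePart (I : Type u) (L : Type v) (V : Type w)
    [Denumerable I] [Denumerable L] [Denumerable V] : Set (Web I L × CLDQuery I L V) :=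
  {p | p.2 ∈ admissibleQueries I L V ∧ (reachablePart p.1 p.2.S p.2.c p.2.B).IsFinite}

/-- The pairs of a Web and an admissible query for which the query result is finite. -/
def FinitenessQueryResult (I : Type u) (L : Type v) (V : Type w)
    [Denumerable I] [Denumerable L] [Denumerable V] : Set (Web I L × CLDQuery I L V) :=
  {p | p.2 ∈ admissibleQueries I L V ∧ (queryResult p.1 p.2.S p.2.c p.2.B).Finite}

end Problems

end LinkedData

/-! The reason is a use principle. The Web influences a run only through expand steps, and each of
them depends on at most one lookup, so a halting run depends on finitely many identifiers
(`LDMachine.exists_finset_run_eq`). Hence a negative answer over `W` is given over every Web that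
agrees with `W` on some finite set of identifiers (`LDMachineDecidable.exists_finset_notMem`).

Both problems have a negative answer for one fixed admissible query over an infinite chain of
documents, where the reachable part and the query result are infinite. Deleting from the chain all
documents except those denoted by the looked-up identifiers leaves a finite Web that the rejecting
run cannot distinguish from the chain. Over a finite Web both answers are positive for this query, a
contradiction (`not_ldMachineDecidable_of_chainWeb`). -/

namespace LinkedData

/-! ### The Web tape contains the block of every identifier in the domain -/

section Tape

variable {I : Type*} {L : Type*} [Denumerable I] [Denumerable L]

theorem Web.encInit_succ (W : Web I L) (n : ℕ) :
    W.encInit (n + 1) = W.encInit n ++ W.encBlock n := by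
  simp [Web.encInit, List.range_succ]

theorem Web.encInit_prefix (W : Web I L) {m n : ℕ} (h : m ≤ n) :
    W.encInit m <+: W.encInit n := by
  induction n, h using Nat.le_induction with
  | base => exact List.prefix_rfl
  | succ n _ ih => exact ih.trans ⟨_, (W.encInit_succ n).symm⟩

/-- The initial parts are prefixes of one another, so the least `N` chosen in `Web.tape` may be
replaced by any sufficiently large one. -/
theorem Web.tape_eq_getElem (W : Web I L) {N k : ℕ} (hk : k < (W.encInit N).length) :
    W.tape k = some (W.encInit N)[k] := by
  classical
  have h : ∃ N, k < (W.encInit N).length := ⟨N, hk⟩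
  rw [Web.tape, dif_pos h]
  have h1 := (W.encInit_prefix (Nat.find_min' h hk)).getElem (Nat.find_spec h)
  rw [List.getElem?_eq_getElem (Nat.find_spec h), h1]

/-- Each initial part of the encoding of a Web ends with the separator. -/
theorem Web.exists_encInit_eq_append_sharp (W : Web I L) (n : ℕ) :
    ∃ p, W.encInit n = p ++ [Symbol.sharp] := by
  induction n with
  | zero => exact ⟨[], rfl⟩
  | succ n ih =>
    rw [W.encInit_succ]
    rcases h : W.adoc (Denumerable.ofNat I n) with _ | d
    · simpa [Web.encBlock, h] using ih
    · exact ⟨W.encInit n ++ (encId (Denumerable.ofNat I n) ++ W.encDoc d),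
        by simp [Web.encBlock, h]⟩

/-- The leading separator is the last symbol of the initial part before the block of `i`; the block
supplies the rest. Hence the occurrence test in `expansion` always succeeds once `adoc` is defined.
-/
theorem Web.occursOn_tape (W : Web I L) {i : I} {d : W.D} (h : W.adoc i = some d) :
    OccursOn ([Symbol.sharp] ++ encId i ++ W.encDoc d ++ [Symbol.sharp]) W.tape := by
  obtain ⟨p, hp⟩ := W.exists_encInit_eq_append_sharp (Encodable.encode i)
  have hw : W.encInit (Encodable.encode i + 1) =
      p ++ ([Symbol.sharp] ++ encId i ++ W.encDoc d ++ [Symbol.sharp]) := by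
    rw [W.encInit_succ, hp, Web.encBlock, Denumerable.ofNat_encode, h]
    simp
  refine ⟨p.length, fun k hk => ?_⟩
  rw [W.tape_eq_getElem (N := Encodable.encode i + 1) (by rw [hw, List.length_append]; omega)]
  simp only [hw, List.getElem_append_right' p hk]
  congr 2
  omega

end Tape

/-! ### Finite runs depend on finitely many lookups -/

section UsePrinciple

variable {I : Type*} {L : Type*} [Denumerable I] [Denumerable L]

/-- Two Webs agree on an identifier if its lookup has the same outcome in both of them. -/
def Web.AgreeOn (W W' : Web I L) (i : I) : Prop :=
  (W.adoc i).map W.data = (W'.adoc i).map W'.data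

/-- In this form the Web enters only through the optional data set of one identifier, which is
comparable between Webs with different types of documents. The default `[]` covers both a missing
suffix identifier and an undefined `adoc`. -/
theorem expansion_eq (W : Web I L) {A : Type} (x : List (Cell A)) :
    expansion W x = (((suffixId I x).bind fun i => (W.adoc i).map W.data).elim []
      (encFinset encDataTriple)) ++ [Symbol.sharp] := by
  unfold expansion
  rcases hs : suffixId I x with _ | i
  · rfl
  · rcases hd : W.adoc i with _ | d
    · simp [hd]
    · simp only [if_pos (W.occursOn_tape hd), Option.bind_some, hd]
      rfl

theorem expansion_congr {W W' : Web I L} {A : Type} {x : List (Cell A)}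
    (h : ∀ i, suffixId I x = some i → W.AgreeOn W' i) : expansion W x = expansion W' x := by
  rw [expansion_eq, expansion_eq]
  rcases hs : suffixId I x with _ | i
  · rfl
  · simp only [Option.bind_some, show _ = _ from h i hs]

namespace LDMachine

variable (M : LDMachine)

theorem step_congr {W W' : Web I L} {C : M.Config}
    (h : ∀ i, suffixId I C.link.word = some i → W.AgreeOn W' i) : M.step W C = M.step W' C := by
  unfold step
  rw [expansion_congr h]

theorem run_succ (W : Web I L) (x : List Symbol) (n : ℕ) :
    M.run W x (n + 1) = M.step W (M.run W x n) :=
  Function.iterate_succ_apply' _ _ _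

/-- A finite part of a run looks up only finitely many identifiers. -/
theorem exists_finset_run_eq (W : Web I L) (x : List Symbol) (n : ℕ) :
    ∃ F : Finset I, ∀ W' : Web I L, (∀ i ∈ F, W.AgreeOn W' i) → M.run W x n = M.run W' x n := by
  classical
  induction n with
  | zero => exact ⟨∅, fun _ _ => rfl⟩
  | succ n ih =>
    obtain ⟨F, hF⟩ := ih
    -- The only identifier that the next step can look up is added, whether or not the state is the
    -- expand state.
    refine ⟨F ∪ (suffixId I (M.run W x n).link.word).toFinset, fun W' h => ?_⟩
    rw [run_succ, run_succ, ← hF W' fun i hi => h i (Finset.mem_union_left _ hi)]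
    exact M.step_congr fun i hi => h i (Finset.mem_union_right _ (by simp [hi]))

theorem run_eq_of_halted {W : Web I L} {x : List Symbol} {m n : ℕ} (hmn : m ≤ n)
    (h : (M.run W x m).state = M.accept ∨ (M.run W x m).state = M.reject) :
    M.run W x n = M.run W x m := by
  induction n, hmn using Nat.le_induction with
  | base => rfl
  | succ n _ ih =>
    rw [run_succ, ih, step, if_pos h]

theorem not_accepts_and_rejects (W : Web I L) (x : List Symbol) :
    ¬ (M.Accepts W x ∧ M.Rejects W x) := by
  rintro ⟨⟨m, hm⟩, ⟨n, hn⟩⟩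
  apply M.accept_ne_reject
  rcases le_total m n with h | h
  · rw [← hm, ← hn, M.run_eq_of_halted h (Or.inl hm)]
  · rw [← hm, ← hn, M.run_eq_of_halted h (Or.inr hn)]

end LDMachine

/-- A negative answer of an LD machine depends on finitely many lookups only. -/
theorem LDMachineDecidable.exists_finset_notMem {X : Type*} {enc : X → List Symbol} {𝒳 : Set X}
    {DP : Set (Web I L × X)} (h : LDMachineDecidable enc Set.univ 𝒳 DP) {W : Web I L} {x : X}
    (hx : x ∈ 𝒳) (hW : (W, x) ∉ DP) :
    ∃ F : Finset I, ∀ W' : Web I L, (∀ i ∈ F, W.AgreeOn W' i) → (W', x) ∉ DP := by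
  obtain ⟨M, hM⟩ := h
  obtain ⟨n, hn⟩ := (hM W trivial x hx).2 hW
  obtain ⟨F, hF⟩ := M.exists_finset_run_eq W (enc x) n
  -- Over `W'` the machine also rejects after `n` steps, whereas membership would make it accept.
  refine ⟨F, fun W' hW' hmem => M.not_accepts_and_rejects W' (enc x)
    ⟨(hM W' trivial x hx).1 hmem, n, ?_⟩⟩
  rw [← hF W' hW', hn]

end UsePrinciple

/-! ### Finite Webs and valuations of a single variable -/

section Valuation

variable {I : Type*} {L : Type*} {V : Type*}

theorem Web.IsFinite.finite_allData {W : Web I L} (hW : W.IsFinite) : W.allData.Finite := by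
  have : Finite W.D := hW
  have h : W.allData = ⋃ d, (W.data d : Set (DataTriple I L)) := by
    ext t
    simp [Web.allData]
  rw [h]
  exact Set.finite_iUnion fun d => (W.data d).finite_toSet

theorem Valuation.ext_of_dom_eq_singleton {μ ν : Valuation I L V} {x : V} (hμ : μ.dom = {x})
    (hν : ν.dom = {x}) (h : μ.toFun x = ν.toFun x) : μ = ν := by
  obtain ⟨f, hf⟩ := μ
  obtain ⟨g, hg⟩ := ν
  congr
  funext y
  by_cases hy : y = x
  · rw [hy]; exact h
  · have h1 : y ∉ Valuation.dom ⟨f, hf⟩ := by rw [hμ]; exact hy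
    have h2 : y ∉ Valuation.dom ⟨g, hg⟩ := by rw [hν]; exact hy
    simp only [Valuation.dom, Set.mem_ofPred_eq, Option.not_isSome_iff_eq_none] at h1 h2
    rw [h1, h2]

theorem Valuation.applyTerm_var {μ : Valuation I L V} {x : V} {a : I ⊕ L}
    (h : μ.toFun x = some a) : μ.applyTerm (Sum.inl x) = Sum.inr a := by
  simp [Valuation.applyTerm, h]

open Classical in
/-- The valuation that maps `x` to `a` and is undefined elsewhere. -/
noncomputable def Valuation.single (x : V) (a : I ⊕ L) : Valuation I L V where
  toFun := fun y => if y = x then some a else none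
  finite_dom := (Set.finite_singleton x).subset fun y hy => by
    by_contra h
    simp_all

theorem Valuation.single_toFun_self (x : V) (a : I ⊕ L) :
    (Valuation.single x a).toFun x = some a := by
  simp [Valuation.single]

theorem Valuation.dom_single (x : V) (a : I ⊕ L) : (Valuation.single x a).dom = {x} := by
  ext y
  by_cases h : y = x <;> simp [Valuation.dom, Valuation.single, h]

end Valuation

/-! ### The infinite chain and its finite truncations -/

section ChainWeb

variable (I : Type*) (L : Type*) (V : Type*) [Denumerable I] [Denumerable L] [Denumerable V]

/-- The Web whose documents are the elements of `s`, where the document `n` is denoted by the `n`-th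
identifier and links to the next one. -/
def chainWeb (s : Set ℕ) [DecidablePred (· ∈ s)] : Web I L where
  D := s
  countable_D := inferInstance
  data n := {(Denumerable.ofNat I 0, Denumerable.ofNat I 0, Sum.inl (Denumerable.ofNat I (n + 1)))}
  adoc i := if h : Encodable.encode i ∈ s then some ⟨Encodable.encode i, h⟩ else none
  adoc_surj := fun ⟨n, hn⟩ => ⟨Denumerable.ofNat I n, by simp [hn]⟩

/-- The query with the pattern `(i, i, x)`, where `i` is the first identifier and `x` the first
variable, with the seed `i` and the criterion that is always true. -/
def chainQuery : CLDQuery I L V where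
  S := {Denumerable.ofNat I 0}
  B := {(Sum.inr (Denumerable.ofNat I 0), Sum.inr (Denumerable.ofNat I 0),
    Sum.inl (Denumerable.ofNat V 0))}
  c := ⟨fun _ _ _ => true, Computable.const true⟩
  -- The value `1` is the code of `true`.
  program := Nat.Partrec.Code.const 1
  program_eval := fun n => Nat.Partrec.Code.eval_const 1 n

theorem chainQuery_mem_admissibleQueries : chainQuery I L V ∈ admissibleQueries I L V := by
  refine ⟨Finset.singleton_nonempty _, fun _ _ _ _ => rfl, ?_⟩
  exact ⟨(Denumerable.ofNat I 0, Denumerable.ofNat I 0, Sum.inl (Denumerable.ofNat I 0)),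
    Denumerable.ofNat I 0, ∅, rfl, rfl⟩

variable {I L V}

theorem reachable_chainWeb_univ (n : ℕ) :
    Reachable (chainWeb I L Set.univ) (chainQuery I L V).S (chainQuery I L V).c
      (chainQuery I L V).B ⟨n, trivial⟩ := by
  induction n with
  | zero =>
    exact .seed (Finset.mem_singleton_self _) (by simp [chainWeb])
  | succ n ih =>
    exact .link (i := Denumerable.ofNat I (n + 1)) ih (Finset.mem_singleton_self _)
      (Or.inr (Or.inr rfl)) rfl (by simp [chainWeb])

omit [Denumerable L] in
-- The data of document `n` do not depend on `s`: the link to `n + 1` is kept even if that document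
-- is missing.
theorem agreeOn_chainWeb {s : Set ℕ} [DecidablePred (· ∈ s)] {i : I} (hi : Encodable.encode i ∈ s) :
    (chainWeb I L Set.univ).AgreeOn (chainWeb I L s) i := by
  simp [Web.AgreeOn, chainWeb, hi]

theorem Web.IsFinite.reachablePart {W : Web I L} (hW : W.IsFinite) (S : Finset I)
    (c : ReachabilityCriterion I L V) (B : BQP I L V) :
    (reachablePart W S c B).IsFinite := by
  have : Finite W.D := hW
  exact Subtype.finite

theorem vars_chainQuery : BQP.vars (chainQuery I L V).B = {Denumerable.ofNat V 0} := by
  ext x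
  simp [BQP.vars, chainQuery, TriplePattern.vars, eq_comm]

theorem applyBQP_chainQuery (μ : Valuation I L V) :
    μ.applyBQP (chainQuery I L V).B =
      {(Sum.inr (Sum.inl (Denumerable.ofNat I 0)), Sum.inr (Sum.inl (Denumerable.ofNat I 0)),
        μ.applyTerm (Sum.inl (Denumerable.ofNat V 0)))} := by
  ext g
  simp [Valuation.applyBQP, chainQuery, Valuation.applyPattern, TriplePattern.toGen,
    Valuation.applyTerm, eq_comm]

/-- A solution is determined by its value at the only variable, and this value is the third
component of one of finitely many data triples. -/
theorem Web.IsFinite.finite_queryResult_chainQuery {W : Web I L} (hW : W.IsFinite) :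
    (queryResult W (chainQuery I L V).S (chainQuery I L V).c (chainQuery I L V).B).Finite := by
  have hfin := ((hW.reachablePart (chainQuery I L V).S (chainQuery I L V).c
    (chainQuery I L V).B).finite_allData.image (DataTriple.toGen (V := V)))
  refine Set.Finite.of_finite_image
    (f := fun μ => μ.applyTerm (Sum.inl (Denumerable.ofNat V 0)))
    ((hfin.image fun g => g.2.2).subset ?_) ?_
  · rintro _ ⟨μ, ⟨-, hμ⟩, rfl⟩
    rw [applyBQP_chainQuery, Set.singleton_subset_iff] at hμ
    exact ⟨_, hμ, rfl⟩
  · rintro μ ⟨hμ, -⟩ ν ⟨hν, -⟩ h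
    rw [vars_chainQuery] at hμ hν
    refine Valuation.ext_of_dom_eq_singleton hμ hν ?_
    have h1 : Denumerable.ofNat V 0 ∈ μ.dom := by rw [hμ]; rfl
    have h2 : Denumerable.ofNat V 0 ∈ ν.dom := by rw [hν]; rfl
    obtain ⟨a, ha⟩ := Option.isSome_iff_exists.1 h1
    obtain ⟨b, hb⟩ := Option.isSome_iff_exists.1 h2
    simp only [Valuation.applyTerm_var ha, Valuation.applyTerm_var hb] at h
    rw [ha, hb, Sum.inr.inj h]

/-- The triple of the reachable document `n` is the witness. Distinct `n` give distinct values,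
which makes the result infinite. -/
theorem single_mem_queryResult (n : ℕ) :
    Valuation.single (Denumerable.ofNat V 0) (Sum.inl (Denumerable.ofNat I (n + 1))) ∈
      queryResult (chainWeb I L Set.univ) (chainQuery I L V).S (chainQuery I L V).c
        (chainQuery I L V).B := by
  refine ⟨by rw [Valuation.dom_single, vars_chainQuery], ?_⟩
  rw [applyBQP_chainQuery, Set.singleton_subset_iff,
    Valuation.applyTerm_var (Valuation.single_toFun_self _ _)]
  exact ⟨_, ⟨⟨⟨n, trivial⟩, reachable_chainWeb_univ n⟩, Finset.mem_singleton_self _⟩, rfl⟩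

theorem infinite_queryResult_chainWeb :
    (queryResult (chainWeb I L Set.univ) (chainQuery I L V).S (chainQuery I L V).c
      (chainQuery I L V).B).Infinite := by
  refine Set.infinite_of_injective_forall_mem (fun m n h => ?_)
    (single_mem_queryResult (I := I) (L := L) (V := V))
  have h' := congrArg (fun μ => μ.toFun (Denumerable.ofNat V 0)) h
  simp only [Valuation.single_toFun_self, Option.some.injEq, Sum.inl.injEq] at h'
  simpa using congrArg Encodable.encode h'

theorem not_isFinite_reachablePart_chainWeb :
    ¬ (reachablePart (chainWeb I L Set.univ) (chainQuery I L V).S (chainQuery I L V).c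
      (chainQuery I L V).B).IsFinite := by
  intro h
  have : Infinite (reachablePart (chainWeb I L Set.univ) (chainQuery I L V).S
      (chainQuery I L V).c (chainQuery I L V).B).D :=
    Infinite.of_injective (fun n => ⟨⟨n, trivial⟩, reachable_chainWeb_univ n⟩)
      fun m n hmn => congrArg (fun d => d.1.1) hmn
  exact this.not_finite h

/-- A problem that holds for the chain query over all finite Webs, but not over the infinite chain,
is not LD machine decidable. -/
theorem not_ldMachineDecidable_of_chainWeb {DP : Set (Web I L × CLDQuery I L V)}
    (hfin : ∀ W : Web I L, W.IsFinite → (W, chainQuery I L V) ∈ DP)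
    (hinf : (chainWeb I L Set.univ, chainQuery I L V) ∉ DP) :
    ¬ LDMachineDecidable CLDQuery.enc Set.univ (admissibleQueries I L V) DP := by
  classical
  intro h
  obtain ⟨F, hF⟩ := h.exists_finset_notMem (chainQuery_mem_admissibleQueries I L V) hinf
  -- The truncation keeps exactly the documents denoted by identifiers in `F`; it is finite and may
  -- leave gaps in the chain.
  refine hF (chainWeb I L (Encodable.encode '' (F : Set I)))
    (fun i hi => agreeOn_chainWeb ⟨i, hi, rfl⟩) (hfin _ ?_)
  exact (F.finite_toSet.image _).to_subtype

end ChainWeb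

end LinkedData

theorem mainTheorem1 (I L V : Type*) [Denumerable I] [Denumerable L] [Denumerable V] :
    ¬ LinkedData.LDMachineDecidable (LinkedData.CLDQuery.enc (I := I) (L := L) (V := V))
        Set.univ (LinkedData.admissibleQueries I L V)
        (LinkedData.FinitenessReachablePart I L V) ∧
      ¬ LinkedData.LDMachineDecidable (LinkedData.CLDQuery.enc (I := I) (L := L) (V := V))
        Set.univ (LinkedData.admissibleQueries I L V)
        (LinkedData.FinitenessQueryResult I L V) :=
  ⟨LinkedData.not_ldMachineDecidable_of_chainWeb
      (fun _ hW => ⟨LinkedData.chainQuery_mem_admissibleQueries I L V, hW.reachablePart _ _ _⟩)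
      (fun h => LinkedData.not_isFinite_reachablePart_chainWeb h.2),
    LinkedData.not_ldMachineDecidable_of_chainWeb
      (fun _ hW => ⟨LinkedData.chainQuery_mem_admissibleQueries I L V,
        hW.finite_queryResult_chainQuery⟩)
      (fun h => LinkedData.infinite_queryResult_chainWeb h.2)⟩
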